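/- Let $\mathcal H$ be the set of hexagons of the regular hexagonal tiling of the Euclidean plane; two hexagons are adjacent if they are different and share an edge. A hexagonal system is a subset $\mathcal K\subseteq\mathcal H$; its connected components are the classes of the relation "joined by a sequence of consecutively adjacent hexagons of $\mathcal K$", and $\mathcal K$ is connected if it has exactly one component. A coronoid is a finite connected hexagonal system. A benzenoid is a coronoid whose complement $\mathcal K^\complement=\mathcal H\setminus\mathcal K$ is connected, and a proper coronoid is a coronoid that is not a benzenoid. Let $b(\mathcal K)$ be the number of connected components of $\mathcal K^\complement$; the finite ones are called corona holes. Let $G(\mathcal K)$ be the graph formed by the vertices and edges of the tiling that are incident with at least one hexagon of $\mathcal K$. An edge of $G(\mathcal K)$ is internal if it belongs to two hexagons of $\mathcal K$ and a boundary edge if it belongs to exactly one; a vertex of $G(\mathcal K)$ is internal if it is incident with three internal edges, and a boundary vertex otherwise. The border $\partial\mathcal K$ is the subgraph of $G(\mathcal K)$ consisting of all boundary vertices and all boundary edges. **Proposition.** Let $\mathcal K$ be a coronoid. Then $b(\mathcal K)$ is finite, $b(\mathcal K)\ge 1$, and $\partial\mathcal K$ is the union of exactly $b(\mathcal K)$ pairwise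 vertex-disjoint cycles, one for each connected component of $\mathcal K^\complement$: the edges of the cycle of a component $\mathcal B$ are exactly the boundary edges that lie on a hexagon of $\mathcal B$. In particular, $\partial\mathcal K$ has exactly $b(\mathcal K)$ connected components. Moreover, $\mathcal K$ is a benzenoid if and only if $b(\mathcal K)=1$, it is a proper coronoid if and only if $b(\mathcal K)>1$, and it has exactly $b(\mathcal K)-1$ corona holes. -/

import Mathlib

/-!
The hexagonal grid in the Euclidean plane (hexagons of unit side length) as a cell complex with
integer coordinates. The 2-cell (hexagon) `(a, b)` is centred at `a • (√3, 0) + b • (√3/2, 3/2)`.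
-/

namespace HexGrid

/-- The hexagons (2-cells) of the infinite hexagonal grid. -/
abbrev Hexagon : Type := ℤ × ℤ

/-- The vertices (0-cells) of the grid: `up a b` is the common point of the three mutually adjacent
hexagons `(a, b)`, `(a + 1, b)`, `(a, b + 1)`, and `down a b` is the common point of the three
mutually adjacent hexagons `(a + 1, b)`, `(a, b + 1)`, `(a + 1, b + 1)`. -/
inductive Vertex : Type
  | up (a b : ℤ) : Vertex
  | down (a b : ℤ) : Vertex

/-- The three hexagons incident with a vertex. -/
def Vertex.hexagons : Vertex → Set Hexagon
  | .up a b => {(a, b), (a + 1, b), (a, b + 1)}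
  | .down a b => {(a + 1, b), (a, b + 1), (a + 1, b + 1)}

/-- The end `down` of an edge of the hexagonal lattice whose other end is `up a b`. -/
def UpDown (u v : Vertex) : Prop :=
  ∃ a b : ℤ, u = .up a b ∧ (v = .down a b ∨ v = .down (a - 1) b ∨ v = .down a (b - 1))

/-- The hexagonal lattice: the 1-skeleton of the hexagonal grid. -/
def hexLattice : SimpleGraph Vertex where
  Adj u v := UpDown u v ∨ UpDown v u
  symm := ⟨fun _ _ h => h.symm⟩
  loopless := ⟨by
    rintro u (⟨a, b, rfl, h⟩ | ⟨a, b, rfl, h⟩) <;> simp at h⟩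

/-- The hexagons whose boundary contains the lattice edge `uv`. -/
def edgeHexagons (u v : Vertex) : Set Hexagon := u.hexagons ∩ v.hexagons

/-! The coordinates describe the regular hexagonal grid in the plane (here `ℂ`). -/

/-- The centre of a hexagon. -/
noncomputable def center (h : Hexagon) : ℂ :=
  ⟨√3 * (h.1 + h.2 / 2), 3 / 2 * h.2⟩

/-- The position of a vertex. -/
noncomputable def Vertex.pos : Vertex → ℂ
  | .up a b => ⟨√3 * (a + b / 2 + 1 / 2), 3 / 2 * b + 1 / 2⟩
  | .down a b => ⟨√3 * (a + b / 2 + 1), 3 / 2 * b + 1⟩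

theorem quad_eq_zero_iff (m n : ℤ) :
    m ^ 2 + m * n + n ^ 2 = m + n ↔ (m = 0 ∧ n = 0) ∨ (m = 1 ∧ n = 0) ∨ (m = 0 ∧ n = 1) := by
  constructor
  · intro h
    have h1 : m ≤ 1 := by nlinarith [sq_nonneg (m + 2 * n - 1), sq_nonneg (m - 1)]
    have h2 : -1 ≤ m := by nlinarith [sq_nonneg (m + 2 * n - 1), sq_nonneg (m + 1)]
    have h3 : n ≤ 1 := by nlinarith [sq_nonneg (n + 2 * m - 1), sq_nonneg (n - 1)]
    have h4 : -1 ≤ n := by nlinarith [sq_nonneg (n + 2 * m - 1), sq_nonneg (n + 1)]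
    interval_cases m <;> interval_cases n <;> simp_all
  · rintro (⟨rfl, rfl⟩ | ⟨rfl, rfl⟩ | ⟨rfl, rfl⟩) <;> norm_num

theorem dist_mk_eq_one_iff (x x' y y' : ℝ) :
    dist (⟨√3 * x, y⟩ : ℂ) ⟨√3 * x', y'⟩ = 1 ↔ 3 * (x - x') ^ 2 + (y - y') ^ 2 = 1 := by
  have h3 : √3 ^ 2 = 3 := Real.sq_sqrt (by norm_num)
  rw [Complex.dist_eq, ← sq_eq_sq₀ (norm_nonneg _) zero_le_one, ← Complex.normSq_eq_norm_sq,
    Complex.normSq_apply]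
  have : (√3 * x - √3 * x') * (√3 * x - √3 * x') + (y - y') * (y - y')
      = 3 * (x - x') ^ 2 + (y - y') ^ 2 := by
    linear_combination (x - x') ^ 2 * h3
  simp [this]

/-- A vertex lies on the boundary of a hexagon iff it is one of the points at distance `1` from
the centre (the corners of a regular hexagon of unit side). -/
theorem mem_hexagons_iff (v : Vertex) (h : Hexagon) :
    h ∈ v.hexagons ↔ dist v.pos (center h) = 1 := by
  obtain ⟨c, d⟩ := h
  cases v with
  | up a b =>
    have key := quad_eq_zero_iff (c - a) (d - b)
    rw [Vertex.pos, center, dist_mk_eq_one_iff]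
    have e : (3 * ((a + b / 2 + 1 / 2 : ℝ) - (c + d / 2)) ^ 2
        + ((3 / 2 * b + 1 / 2 : ℝ) - 3 / 2 * d) ^ 2 = 1) ↔
        (c - a) ^ 2 + (c - a) * (d - b) + (d - b) ^ 2 = (c - a) + (d - b) := by
      rw [← @Int.cast_inj ℝ]
      push_cast
      constructor <;> intro h <;> linarith
    rw [e, key]
    simp only [Vertex.hexagons, Set.mem_insert_iff, Set.mem_singleton_iff, Prod.mk.injEq]
    omega
  | down a b =>
    have key := quad_eq_zero_iff (a + 1 - c) (b + 1 - d)
    rw [Vertex.pos, center, dist_mk_eq_one_iff]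
    have e : (3 * ((a + b / 2 + 1 : ℝ) - (c + d / 2)) ^ 2
        + ((3 / 2 * b + 1 : ℝ) - 3 / 2 * d) ^ 2 = 1) ↔
        (a + 1 - c) ^ 2 + (a + 1 - c) * (b + 1 - d) + (b + 1 - d) ^ 2
          = (a + 1 - c) + (b + 1 - d) := by
      rw [← @Int.cast_inj ℝ]
      push_cast
      constructor <;> intro h <;> linarith
    rw [e, key]
    simp only [Vertex.hexagons, Set.mem_insert_iff, Set.mem_singleton_iff, Prod.mk.injEq]
    omega

theorem upDown_iff (a b c d : ℤ) :
    UpDown (.up a b) (.down c d) ↔ dist (Vertex.up a b).pos (Vertex.down c d).pos = 1 := by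
  have key := quad_eq_zero_iff (a - c) (b - d)
  rw [Vertex.pos, Vertex.pos, dist_mk_eq_one_iff]
  have e : (3 * ((a + b / 2 + 1 / 2 : ℝ) - (c + d / 2 + 1)) ^ 2
      + ((3 / 2 * b + 1 / 2 : ℝ) - (3 / 2 * d + 1)) ^ 2 = 1) ↔
      (a - c) ^ 2 + (a - c) * (b - d) + (b - d) ^ 2 = (a - c) + (b - d) := by
    rw [← @Int.cast_inj ℝ]
    push_cast
    constructor <;> intro h <;> linarith
  rw [e, key]
  simp only [UpDown, Vertex.up.injEq, Vertex.down.injEq]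
  constructor
  · rintro ⟨a', b', h, h'⟩
    omega
  · intro h
    exact ⟨a, b, by omega⟩

/-- Two vertices are joined by an edge iff they are at distance `1`. -/
theorem hexLattice_adj_iff (u v : Vertex) : hexLattice.Adj u v ↔ dist u.pos v.pos = 1 := by
  have hne (m n : ℤ) : ¬ (3 * (m ^ 2 + m * n + n ^ 2) = 1) := by omega
  cases u with
  | up a b =>
    cases v with
    | up c d =>
      refine iff_of_false (by simp [hexLattice, UpDown]) fun h => hne (a - c) (b - d) ?_
      rw [Vertex.pos, Vertex.pos, dist_mk_eq_one_iff] at h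
      rw [← @Int.cast_inj ℝ]
      push_cast
      linarith
    | down c d =>
      rw [← upDown_iff]
      simp [hexLattice, UpDown]
  | down a b =>
    cases v with
    | up c d =>
      rw [dist_comm, ← upDown_iff]
      simp [hexLattice, UpDown]
    | down c d =>
      refine iff_of_false (by simp [hexLattice, UpDown]) fun h => hne (a - c) (b - d) ?_
      rw [Vertex.pos, Vertex.pos, dist_mk_eq_one_iff] at h
      rw [← @Int.cast_inj ℝ]
      push_cast
      linarith

/-- The adjacency relation on hexagons: being different and sharing an edge. -/
def grid : SimpleGraph Hexagon where
  Adj h k := h ≠ k ∧ ∃ u v, hexLattice.Adj u v ∧ h ∈ edgeHexagons u v ∧ k ∈ edgeHexagons u v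
  symm := ⟨fun _ _ h => ⟨h.1.symm, by
    obtain ⟨u, v, huv, h1, h2⟩ := h.2
    exact ⟨u, v, huv, h2, h1⟩⟩⟩
  loopless := ⟨fun _ h => h.1 rfl⟩

/-! ### Hexagonal systems, i.e. arbitrary sets of hexagons -/

/-- The connected components of a hexagonal system `K`: the classes of the relation "joined by a
sequence of consecutively adjacent hexagons all lying in `K`". -/
abbrev Component (K : Set Hexagon) : Type := (grid.induce K).ConnectedComponent

/-- The set of hexagons of a component. -/
def Component.cells {K : Set Hexagon} (C : Component K) : Set Hexagon :=
  (fun h : K => (h : Hexagon)) '' C.supp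

/-- A hexagonal system is connected if it has exactly one component (so it is non-empty). -/
def IsConnected (K : Set Hexagon) : Prop := (grid.induce K).Connected

/-- A (general) coronoid is a finite connected hexagonal system. -/
structure IsCoronoid (K : Set Hexagon) : Prop where
  finite : K.Finite
  connected : IsConnected K

/-- A benzenoid is a finite connected hexagonal system whose complement is connected. -/
structure IsBenzenoid (K : Set Hexagon) : Prop where
  finite : K.Finite
  connected : IsConnected K
  compl_connected : IsConnected Kᶜ

/-- A proper coronoid is a coronoid that is not a benzenoid. -/
def IsProperCoronoid (K : Set Hexagon) : Prop := IsCoronoid K ∧ ¬ IsBenzenoid K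

/-- `b(K)`: the number of connected components of the complement of `K`. -/
noncomputable def numComplComponents (K : Set Hexagon) : ℕ := Nat.card (Component Kᶜ)

/-- The corona holes of `K`: the finite connected components of the complement of `K`. -/
def coronaHoles (K : Set Hexagon) : Set (Component Kᶜ) := {B | B.cells.Finite}

/-! ### Skeleton and border -/

/-- The skeleton `G(K)`: the vertices and edges of the lattice incident with a hexagon of `K`. -/
def skeleton (K : Set Hexagon) : hexLattice.Subgraph where
  verts := {v | ∃ h ∈ K, h ∈ v.hexagons}
  Adj u v := hexLattice.Adj u v ∧ ∃ h ∈ K, h ∈ edgeHexagons u v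
  adj_sub h := h.1
  edge_vert := by
    rintro u v ⟨-, h, hK, hu, -⟩
    exact ⟨h, hK, hu⟩
  symm := ⟨by
    rintro u v ⟨huv, h, hK, hu, hv⟩
    exact ⟨huv.symm, h, hK, hv, hu⟩⟩

/-- `uv` is an internal edge of `G(K)`: it belongs to two hexagons of `K`. -/
def IsInternalEdge (K : Set Hexagon) (u v : Vertex) : Prop :=
  (skeleton K).Adj u v ∧ ∃ h ∈ K, ∃ k ∈ K, h ≠ k ∧ h ∈ edgeHexagons u v ∧ k ∈ edgeHexagons u v

/-- `uv` is a boundary edge of `G(K)`: it belongs to exactly one hexagon of `K`. -/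
def IsBoundaryEdge (K : Set Hexagon) (u v : Vertex) : Prop :=
  (skeleton K).Adj u v ∧ ∃! h, h ∈ K ∧ h ∈ edgeHexagons u v

/-- An internal vertex of `G(K)` is incident with three internal edges. -/
def IsInternalVertex (K : Set Hexagon) (v : Vertex) : Prop :=
  v ∈ (skeleton K).verts ∧ {w | IsInternalEdge K v w}.ncard = 3

/-- All other vertices of `G(K)` are boundary vertices. -/
def IsBoundaryVertex (K : Set Hexagon) (v : Vertex) : Prop :=
  v ∈ (skeleton K).verts ∧ ¬ IsInternalVertex K v

/-- Every vertex of the lattice has degree three. -/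
theorem ncard_neighborSet (v : Vertex) :
    (hexLattice.neighborSet v).Finite ∧ (hexLattice.neighborSet v).ncard = 3 := by
  cases v with
  | up a b =>
    have h : hexLattice.neighborSet (.up a b) =
        {.down a b, .down (a - 1) b, .down a (b - 1)} := by
      ext w
      simp only [SimpleGraph.mem_neighborSet, hexLattice, UpDown, Set.mem_insert_iff,
        Set.mem_singleton_iff]
      constructor
      · rintro (⟨a', b', h, hw⟩ | ⟨a', b', rfl, hw⟩)
        · cases h; exact hw
        · simp at hw
      · intro hw
        exact Or.inl ⟨a, b, rfl, hw⟩
    rw [h]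
    refine ⟨by simp, ?_⟩
    rw [Set.ncard_eq_three]
    exact ⟨_, _, _, by simp; try omega, by simp; try omega, by simp; try omega, rfl⟩
  | down a b =>
    have h : hexLattice.neighborSet (.down a b) =
        {.up a b, .up (a + 1) b, .up a (b + 1)} := by
      ext w
      simp only [SimpleGraph.mem_neighborSet, hexLattice, UpDown, Set.mem_insert_iff,
        Set.mem_singleton_iff]
      constructor
      · rintro (⟨a', b', h, hw⟩ | ⟨a', b', rfl, hw⟩)
        · cases h
        · simp only [Vertex.down.injEq] at hw
          simp only [Vertex.up.injEq]
          omega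
      · rintro (rfl | rfl | rfl)
        · exact Or.inr ⟨a, b, rfl, by simp⟩
        · exact Or.inr ⟨a + 1, b, rfl, by simp⟩
        · exact Or.inr ⟨a, b + 1, rfl, by simp⟩
    rw [h]
    refine ⟨by simp, ?_⟩
    rw [Set.ncard_eq_three]
    exact ⟨_, _, _, by simp, by simp, by simp, rfl⟩

theorem IsBoundaryEdge.symm {K : Set Hexagon} {u v : Vertex} (h : IsBoundaryEdge K u v) :
    IsBoundaryEdge K v u := by
  refine ⟨h.1.symm, ?_⟩
  have := h.2
  rwa [edgeHexagons, Set.inter_comm] at this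

/-- The ends of a boundary edge are boundary vertices. -/
theorem IsBoundaryEdge.isBoundaryVertex {K : Set Hexagon} {u v : Vertex}
    (h : IsBoundaryEdge K u v) : IsBoundaryVertex K u := by
  refine ⟨(skeleton K).edge_vert h.1, fun hi => ?_⟩
  obtain ⟨hfin, hcard⟩ := ncard_neighborSet u
  have hsub : {w | IsInternalEdge K u w} ⊆ hexLattice.neighborSet u :=
    fun w hw => hw.1.1
  have heq := Set.eq_of_subset_of_ncard_le hsub (by rw [hcard, hi.2]) hfin
  have hv : IsInternalEdge K u v := by
    have : v ∈ hexLattice.neighborSet u := h.1.1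
    rwa [← heq] at this
  obtain ⟨-, x, hx, y, hy, hne, hxe, hye⟩ := hv
  exact hne (h.2.unique ⟨hx, hxe⟩ ⟨hy, hye⟩)

/-- The border `∂K`: the subgraph of `G(K)` consisting of all boundary vertices and all boundary
edges. -/
def border (K : Set Hexagon) : hexLattice.Subgraph where
  verts := {v | IsBoundaryVertex K v}
  Adj u v := IsBoundaryEdge K u v
  adj_sub h := h.1.1
  edge_vert h := h.isBoundaryVertex
  symm := ⟨fun _ _ h => h.symm⟩

theorem border_le_skeleton (K : Set Hexagon) : border K ≤ skeleton K :=
  ⟨fun _ h => h.1, fun _ _ h => h.1⟩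

/-- A subgraph of the lattice that is a cycle, i.e. the vertices and edges of a closed walk of
positive length without repeated vertices and edges. -/
def IsCycleGraph (H : hexLattice.Subgraph) : Prop :=
  ∃ (v : Vertex) (p : hexLattice.Walk v v), p.IsCycle ∧ p.toSubgraph = H

end HexGrid

open HexGrid

-- Three mutually adjacent hexagons meet at each lattice vertex. If both `K` and its complement
-- occur among them, one of the three is the odd one out, and exactly its two edges at that vertex
-- are border edges; so the border is 2-regular (`ncard_neighborSet_border`). Mutual adjacency also
-- puts all hexagons off `K` at one vertex in the same component of `Kᶜ`, so each border vertex
-- belongs to a single component. The cycle of a component `B` is the border of `B.cells` itself,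
-- and a finite connected 2-regular graph is a cycle.
--
-- What remains is connectedness of that border, a discrete Jordan-type statement
-- (`border_connected`): if `A` and `Aᶜ` are both connected, so is the border of `A`. Crossings with
-- a union `S` of border components define a closed 1-form modulo 2 on the dual triangular lattice,
-- which has a potential because the plane is simply connected. It is constant on `A` and on `Aᶜ`;
-- these two values differ if `S` is non-empty and agree if some border edge misses `S`. The lemma
-- applies to `B.cells` because `K` is connected and no other component of `Kᶜ` can be separated
-- from `K` by `B`.

-- Finite connected 2-regular graphs are cycles

namespace SimpleGraph

/-- A 2-regular finite graph has a cycle through all vertices of a given component, here all of `H`.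
The cycle uses two edges at every vertex, and `H` has no more, so no edge is missed. -/
theorem Subgraph.exists_isCycle_toSubgraph_eq {V : Type*} {G : SimpleGraph V} {H : G.Subgraph}
    (hfin : H.verts.Finite) (hconn : H.Connected)
    (hdeg : ∀ v ∈ H.verts, (H.neighborSet v).ncard = 2) :
    ∃ (v : V) (p : G.Walk v v), p.IsCycle ∧ p.toSubgraph = H := by
  have : Finite H.verts := hfin
  have hn (v : H.verts) : (H.coe.neighborSet v).ncard = 2 := by
    rw [← hdeg v v.2, ← Set.ncard_image_of_injective _ Subtype.val_injective]
    congr 1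
    ext w
    simp only [Set.mem_image, mem_neighborSet, Subtype.exists,
      exists_and_right, exists_eq_right, Subgraph.mem_neighborSet]
    exact ⟨fun h => h.2, fun h => ⟨H.edge_vert h.symm, h⟩⟩
  have hc : H.coe.IsCycles := fun v _ => hn v
  obtain ⟨v⟩ := hconn.coe.nonempty
  obtain ⟨p, hp, hpv⟩ := hc.exists_cycle_toSubgraph_verts_eq_connectedComponentSupp
    (c := H.coe.connectedComponentMk v) (v := v) rfl
    (Set.nonempty_of_ncard_ne_zero (by rw [hn]; norm_num))
  have hpc : (p.map H.hom).IsCycle := hp.map Subgraph.hom_injective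
  have hpv' : (p.map H.hom).toSubgraph.verts = H.verts := by
    rw [Walk.toSubgraph_map, Subgraph.map_verts, hpv]
    ext w
    simp only [Set.mem_image, ConnectedComponent.mem_supp_iff, ConnectedComponent.eq]
    constructor
    · rintro ⟨x, -, rfl⟩
      exact x.2
    · intro hw
      exact ⟨⟨w, hw⟩, hconn.coe.preconnected _ _, rfl⟩
  have hle : (p.map H.hom).toSubgraph ≤ H := by
    rw [Walk.toSubgraph_map]
    refine ⟨?_, ?_⟩
    · rintro _ ⟨x, -, rfl⟩
      exact x.2
    · rintro _ _ ⟨x, y, hxy, rfl, rfl⟩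
      exact (p.toSubgraph.adj_sub hxy : H.coe.Adj x y)
  refine ⟨_, p.map H.hom, hpc, le_antisymm hle ⟨hpv'.ge, fun x y hxy => ?_⟩⟩
  have hx : x ∈ H.verts := H.edge_vert hxy
  have heq := Set.eq_of_subset_of_ncard_le (Subgraph.neighborSet_subset_of_subgraph hle x)
    (by rw [hdeg x hx, hpc.ncard_neighborSet_toSubgraph_eq_two
      ((Walk.mem_verts_toSubgraph _).1 (hpv'.symm ▸ hx))])
    (Set.finite_of_ncard_ne_zero (by rw [hdeg x hx]; norm_num))
  have : y ∈ H.neighborSet x := hxy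
  rwa [← heq] at this

end SimpleGraph

-- Closed 1-forms on the integer plane

namespace Int

theorem exists_forall_add_one_eq_add {M : Type*} [AddCommGroup M] (g : ℤ → M) :
    ∃ F : ℤ → M, F 0 = 0 ∧ ∀ n, F (n + 1) = F n + g n := by
  -- `toNat` empties the second sum for `n ≥ 0` and the first for `n ≤ 0`, so one formula serves
  -- both directions.
  refine ⟨fun n => ∑ i ∈ Finset.range n.toNat, g i -
    ∑ i ∈ Finset.range (-n).toNat, g (-(i + 1)), by simp, fun n => ?_⟩
  rcases le_or_gt 0 n with hn | hn
  · lift n to ℕ using hn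
    beta_reduce
    rw [show ((n : ℤ) + 1).toNat = n + 1 by omega, show (-((n : ℤ) + 1)).toNat = 0 by omega,
      show (-(n : ℤ)).toNat = 0 by omega]
    simp [Finset.sum_range_succ]
  · obtain ⟨m, rfl⟩ : ∃ m : ℕ, n = -(m + 1) := ⟨(-n - 1).toNat, by omega⟩
    beta_reduce
    rw [show (-((m : ℤ) + 1) + 1).toNat = 0 by omega, show (-((m : ℤ) + 1)).toNat = 0 by omega,
      show (-(-((m : ℤ) + 1))).toNat = m + 1 by omega,
      show (-(-((m : ℤ) + 1) + 1)).toNat = m by omega, Finset.sum_range_succ]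
    simp

/-- A closed `1`-form on the square grid is exact. -/
theorem exists_potential {M : Type*} [AddCommGroup M] (f g : ℤ → ℤ → M)
    (h : ∀ a b, f a b + g (a + 1) b = g a b + f a (b + 1)) :
    ∃ φ : ℤ × ℤ → M, (∀ a b, φ (a + 1, b) = φ (a, b) + f a b) ∧
      ∀ a b, φ (a, b + 1) = φ (a, b) + g a b := by
  obtain ⟨F, -, hF⟩ := exists_forall_add_one_eq_add fun a => f a 0
  choose G hG0 hG using fun a => exists_forall_add_one_eq_add (g a)
  -- The potential integrates `f` along row 0 and then `g` up the column. Closedness makes the claim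
  -- for `b` equivalent to that for `b + 1`; `G a 0 = 0` starts the induction in both directions.
  have key (a b : ℤ) : G (a + 1) b = G a b + f a b - f a 0 := by
    have step (b : ℤ) : G (a + 1) b = G a b + f a b - f a 0 ↔
        G (a + 1) (b + 1) = G a (b + 1) + f a (b + 1) - f a 0 := by
      rw [hG, hG, ← eq_sub_iff_add_eq]
      refine Eq.congr_right ?_
      rw [← sub_eq_zero, ← sub_eq_zero.2 (h a b)]
      abel
    induction b using Int.induction_on with
    | zero => simp [hG0]
    | succ i ih => exact (step _).1 ih
    | pred i ih => exact (step _).2 (by simpa using ih)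
  refine ⟨fun p => F p.1 + G p.1 p.2, fun a b => ?_, fun a b => ?_⟩
  · simp only [hF, key]
    abel
  · simp only [hG]
    abel

end Int

-- Local structure at a vertex

namespace HexGrid

/-- A normal form that treats `up` and `down` alike: each neighbour is matched with the hexagon
opposite to its edge. -/
theorem Vertex.exists_hexagons_eq (v : Vertex) : ∃ x y z p q r, x ≠ y ∧ y ≠ z ∧ x ≠ z ∧
    p ≠ q ∧ q ≠ r ∧ p ≠ r ∧ v.hexagons = {x, y, z} ∧ hexLattice.neighborSet v = {p, q, r} ∧
    edgeHexagons v p = {y, z} ∧ edgeHexagons v q = {x, z} ∧ edgeHexagons v r = {x, y} := by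
  cases v with
  | up a b =>
    refine ⟨(a, b), (a + 1, b), (a, b + 1), .down a b, .down (a - 1) b, .down a (b - 1),
      by simp, by simp, by simp, by simp; try omega, by simp; try omega, by simp; try omega,
      rfl, ?_, ?_, ?_, ?_⟩
    · ext w
      simp only [SimpleGraph.mem_neighborSet, hexLattice, UpDown, Set.mem_insert_iff,
        Set.mem_singleton_iff]
      constructor
      · rintro (⟨a', b', h, hw⟩ | ⟨a', b', rfl, hw⟩)
        · cases h; exact hw
        · simp at hw
      · intro hw
        exact Or.inl ⟨a, b, rfl, hw⟩
    all_goals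
      ext ⟨c, d⟩
      simp only [edgeHexagons, Vertex.hexagons, Set.mem_inter_iff, Set.mem_insert_iff,
        Set.mem_singleton_iff, Prod.mk.injEq]
      omega
  | down a b =>
    refine ⟨(a + 1, b + 1), (a, b + 1), (a + 1, b), .up a b, .up (a + 1) b, .up a (b + 1),
      by simp, by simp, by simp, by simp, by simp, by simp, ?_, ?_, ?_, ?_, ?_⟩
    · ext ⟨c, d⟩
      simp only [Vertex.hexagons, Set.mem_insert_iff, Set.mem_singleton_iff, Prod.mk.injEq]
      omega
    · ext w
      simp only [SimpleGraph.mem_neighborSet, hexLattice, UpDown, Set.mem_insert_iff,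
        Set.mem_singleton_iff]
      constructor
      · rintro (⟨a', b', h, hw⟩ | ⟨a', b', rfl, hw⟩)
        · cases h
        · simp only [Vertex.down.injEq] at hw
          simp only [Vertex.up.injEq]
          omega
      · rintro (rfl | rfl | rfl)
        · exact Or.inr ⟨a, b, rfl, by simp⟩
        · exact Or.inr ⟨a + 1, b, rfl, by simp⟩
        · exact Or.inr ⟨a, b + 1, rfl, by simp⟩
    all_goals
      ext ⟨c, d⟩
      simp only [edgeHexagons, Vertex.hexagons, Set.mem_inter_iff, Set.mem_insert_iff,
        Set.mem_singleton_iff, Prod.mk.injEq]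
      omega

theorem exists_edgeHexagons_eq {u v : Vertex} (h : hexLattice.Adj u v) :
    ∃ x y, x ≠ y ∧ edgeHexagons u v = {x, y} := by
  obtain ⟨x, y, z, p, q, r, hxy, hyz, hxz, -, -, -, -, hn, hp, hq, hr⟩ := u.exists_hexagons_eq
  have hv : v ∈ hexLattice.neighborSet u := h
  rw [hn] at hv
  rcases hv with rfl | rfl | rfl
  · exact ⟨y, z, hyz, hp⟩
  · exact ⟨x, z, hxz, hq⟩
  · exact ⟨x, y, hxy, hr⟩

theorem grid_adj_of_mem_hexagons {v : Vertex} {h k : Hexagon} (hh : h ∈ v.hexagons)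
    (hk : k ∈ v.hexagons) (hne : h ≠ k) : grid.Adj h k := by
  obtain ⟨x, y, z, p, q, r, hxy, hyz, hxz, -, -, -, hv, hn, hp, hq, hr⟩ := v.exists_hexagons_eq
  have hvp : hexLattice.Adj v p := by
    rw [← SimpleGraph.mem_neighborSet, hn]; simp
  have hvq : hexLattice.Adj v q := by
    rw [← SimpleGraph.mem_neighborSet, hn]; simp
  have hvr : hexLattice.Adj v r := by
    rw [← SimpleGraph.mem_neighborSet, hn]; simp
  have h1 : grid.Adj y z := ⟨hyz, v, p, hvp, by simp [hp], by simp [hp]⟩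
  have h2 : grid.Adj x z := ⟨hxz, v, q, hvq, by simp [hq], by simp [hq]⟩
  have h3 : grid.Adj x y := ⟨hxy, v, r, hvr, by simp [hr], by simp [hr]⟩
  rw [hv] at hh hk
  rcases hh with rfl | rfl | rfl <;> rcases hk with rfl | rfl | rfl <;>
    first
    | exact absurd rfl hne
    | assumption
    | (apply SimpleGraph.Adj.symm; assumption)

/-- An edge lies on exactly two hexagons. The resulting criterion is symmetric in `K` and `Kᶜ`,
which allows the border of `K` to be compared with that of a component of `Kᶜ`. -/
theorem isBoundaryEdge_iff {K : Set Hexagon} {u v : Vertex} :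
    IsBoundaryEdge K u v ↔ hexLattice.Adj u v ∧ (∃ h ∈ K, h ∈ edgeHexagons u v) ∧
      ∃ h ∉ K, h ∈ edgeHexagons u v := by
  constructor
  · rintro ⟨⟨huv, hK⟩, h, -, hu⟩
    refine ⟨huv, hK, ?_⟩
    by_contra! hcon
    obtain ⟨x, y, hxy, he⟩ := exists_edgeHexagons_eq huv
    have hx := hu x ⟨by by_contra hx; exact hcon x hx (by simp [he]), by simp [he]⟩
    have hy := hu y ⟨by by_contra hy; exact hcon y hy (by simp [he]), by simp [he]⟩
    exact hxy (hx.trans hy.symm)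
  · rintro ⟨huv, ⟨h, hK, he⟩, k, hk, hke⟩
    refine ⟨⟨huv, h, hK, he⟩, h, ⟨hK, he⟩, ?_⟩
    rintro l ⟨hl, hle⟩
    obtain ⟨x, y, hxy, heq⟩ := exists_edgeHexagons_eq huv
    rw [heq] at he hke hle
    rcases he with rfl | rfl <;> rcases hke with rfl | rfl <;> rcases hle with rfl | rfl <;>
      first | rfl | contradiction

theorem isInternalVertex_iff {K : Set Hexagon} {v : Vertex} :
    IsInternalVertex K v ↔ v.hexagons ⊆ K := by
  obtain ⟨x, y, z, p, q, r, hxy, hyz, hxz, hpq, hqr, hpr, hv, hn, hp, hq, hr⟩ :=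
    v.exists_hexagons_eq
  obtain ⟨hfin, hcard⟩ := ncard_neighborSet v
  have hsub : {w | IsInternalEdge K v w} ⊆ hexLattice.neighborSet v := fun w hw => hw.1.1
  constructor
  · rintro ⟨-, h3⟩
    have heq := Set.eq_of_subset_of_ncard_le hsub (by rw [hcard, h3]) hfin
    have key {w : Vertex} {s t : Hexagon} (hw : w ∈ hexLattice.neighborSet v)
        (hst : edgeHexagons v w = {s, t}) : s ∈ K ∧ t ∈ K := by
      rw [← heq] at hw
      obtain ⟨-, h, hh, k, hk, hne, h1, h2⟩ := hw
      rw [hst] at h1 h2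
      rcases h1 with rfl | rfl <;> rcases h2 with rfl | rfl <;>
        first | contradiction | exact ⟨hh, hk⟩ | exact ⟨hk, hh⟩
    obtain ⟨hy, hz⟩ := key (by simp [hn]) hp
    obtain ⟨hx, -⟩ := key (by simp [hn]) hq
    rw [hv]
    rintro _ (rfl | rfl | rfl) <;> assumption
  · intro hK
    have hK' (w : Vertex) : edgeHexagons v w ⊆ K := Set.inter_subset_left.trans hK
    refine ⟨⟨x, hK (by simp [hv]), by simp [hv]⟩, ?_⟩
    rw [← hcard]
    refine congrArg _ (hsub.antisymm fun w hw => ?_)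
    obtain ⟨s, t, hst, he⟩ := exists_edgeHexagons_eq hw
    have hs : s ∈ edgeHexagons v w := by simp [he]
    have ht : t ∈ edgeHexagons v w := by simp [he]
    exact ⟨⟨hw, s, hK' w hs, hs⟩, s, hK' w hs, t, hK' w ht, hst, hs, ht⟩

theorem mem_border_verts_iff {K : Set Hexagon} {v : Vertex} :
    v ∈ (border K).verts ↔ (∃ h ∈ K, h ∈ v.hexagons) ∧ ∃ h ∉ K, h ∈ v.hexagons := by
  refine and_congr Iff.rfl ?_
  rw [isInternalVertex_iff, Set.not_subset]
  exact exists_congr fun _ => and_comm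

theorem border_adj_iff {K : Set Hexagon} {u v : Vertex} :
    (border K).Adj u v ↔ hexLattice.Adj u v ∧ (∃ h ∈ K, h ∈ edgeHexagons u v) ∧
      ∃ h ∉ K, h ∈ edgeHexagons u v :=
  isBoundaryEdge_iff

/-- The border is regular of degree two. -/
theorem ncard_neighborSet_border {K : Set Hexagon} {v : Vertex} (h : v ∈ (border K).verts) :
    ((border K).neighborSet v).ncard = 2 := by
  obtain ⟨x, y, z, p, q, r, hxy, hyz, hxz, hpq, hqr, hpr, hv, hn, hp, hq, hr⟩ :=
    v.exists_hexagons_eq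
  have hmem (w : Vertex) : w ∈ (border K).neighborSet v ↔
      (w = p ∧ (y ∈ K ∧ z ∉ K ∨ y ∉ K ∧ z ∈ K)) ∨ (w = q ∧ (x ∈ K ∧ z ∉ K ∨ x ∉ K ∧ z ∈ K)) ∨
        (w = r ∧ (x ∈ K ∧ y ∉ K ∨ x ∉ K ∧ y ∈ K)) := by
    rw [SimpleGraph.Subgraph.mem_neighborSet, border_adj_iff, ← SimpleGraph.mem_neighborSet, hn]
    constructor
    · rintro ⟨rfl | rfl | rfl, h1, h2⟩
      · simp only [hp, Set.mem_insert_iff, Set.mem_singleton_iff] at h1 h2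
        grind
      · simp only [hq, Set.mem_insert_iff, Set.mem_singleton_iff] at h1 h2
        grind
      · simp only [hr, Set.mem_insert_iff, Set.mem_singleton_iff] at h1 h2
        grind
    · rintro (⟨rfl, h⟩ | ⟨rfl, h⟩ | ⟨rfl, h⟩)
      · simp only [hp, Set.mem_insert_iff, Set.mem_singleton_iff]
        grind
      · simp only [hq, Set.mem_insert_iff, Set.mem_singleton_iff]
        grind
      · simp only [hr, Set.mem_insert_iff, Set.mem_singleton_iff]
        grind
  rw [mem_border_verts_iff, hv] at h
  simp only [Set.mem_insert_iff, Set.mem_singleton_iff] at h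
  rw [Set.ncard_eq_two]
  -- The neighbours are those along the two edges of the hexagon that is alone on its side; the two
  -- unanimous cases contradict `h`.
  by_cases hxK : x ∈ K <;> by_cases hyK : y ∈ K <;> by_cases hzK : z ∈ K
  · grind
  · exact ⟨p, q, hpq, by ext w; simp [*]⟩
  · exact ⟨p, r, hpr, by ext w; simp [*]⟩
  · exact ⟨q, r, hqr, by ext w; simp [*]⟩
  · exact ⟨q, r, hqr, by ext w; simp [*]⟩
  · exact ⟨p, r, hpr, by ext w; simp [*]⟩
  · exact ⟨p, q, hpq, by ext w; simp [*]⟩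
  · grind

theorem exists_border_adj {K : Set Hexagon} {v : Vertex} (h : v ∈ (border K).verts) :
    ∃ w, (border K).Adj v w :=
  Set.nonempty_of_ncard_ne_zero (s := (border K).neighborSet v)
    (by rw [ncard_neighborSet_border h]; norm_num)

theorem finite_skeleton_verts {K : Set Hexagon} (hK : K.Finite) : (skeleton K).verts.Finite := by
  refine (hK.biUnion (t := fun h => {Vertex.up h.1 h.2, .up (h.1 - 1) h.2, .up h.1 (h.2 - 1),
    .down (h.1 - 1) h.2, .down h.1 (h.2 - 1), .down (h.1 - 1) (h.2 - 1)})
    fun h _ => Set.toFinite _).subset ?_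
  rintro (⟨a, b⟩ | ⟨a, b⟩) ⟨h, hK, rfl | rfl | rfl⟩ <;>
    exact Set.mem_biUnion hK (by simp)

end HexGrid

-- Paths along rows and columns

namespace SimpleGraph

theorem Reachable.eq_of_forall_adj {V α : Type*} {G : SimpleGraph V} {f : V → α}
    (hf : ∀ u v, G.Adj u v → f u = f v) {u v : V} (h : G.Reachable u v) : f u = f v := by
  obtain ⟨p⟩ := h
  induction p with
  | nil => rfl
  | cons hadj _ ih => exact (hf _ _ hadj).trans ih

theorem reachable_of_forall_adj_add_one {V : Type*} {G : SimpleGraph V} {e : ℤ → V}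
    (he : ∀ n, G.Adj (e n) (e (n + 1))) (m n : ℤ) : G.Reachable (e m) (e n) := by
  have key (n : ℤ) : G.Reachable (e 0) (e n) := by
    induction n using Int.induction_on with
    | zero => rfl
    | succ i ih => exact ih.trans (he _).reachable
    | pred i ih =>
      have := he (-i - 1)
      rw [sub_add_cancel] at this
      exact ih.trans this.symm.reachable
  exact (key m).symm.trans (key n)

end SimpleGraph

namespace HexGrid

theorem grid_adj_fst_add_one (a b : ℤ) : grid.Adj (a, b) (a + 1, b) :=
  grid_adj_of_mem_hexagons (v := .up a b) (by simp [Vertex.hexagons]) (by simp [Vertex.hexagons])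
    (by simp)

theorem grid_adj_snd_add_one (a b : ℤ) : grid.Adj (a, b) (a, b + 1) :=
  grid_adj_of_mem_hexagons (v := .up a b) (by simp [Vertex.hexagons]) (by simp [Vertex.hexagons])
    (by simp)

theorem reachable_of_row_subset {L : Set Hexagon} {b : ℤ} (h : ∀ a, (a, b) ∈ L) (a a' : ℤ) :
    (grid.induce L).Reachable ⟨(a, b), h a⟩ ⟨(a', b), h a'⟩ :=
  SimpleGraph.reachable_of_forall_adj_add_one (e := fun a => (⟨(a, b), h a⟩ : L))
    (fun a => grid_adj_fst_add_one a b) a a'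

theorem reachable_of_column_subset {L : Set Hexagon} {a : ℤ} (h : ∀ b, (a, b) ∈ L) (b b' : ℤ) :
    (grid.induce L).Reachable ⟨(a, b), h b⟩ ⟨(a, b'), h b'⟩ :=
  SimpleGraph.reachable_of_forall_adj_add_one (e := fun b => (⟨(a, b), h b⟩ : L))
    (fun b => grid_adj_snd_add_one a b) b b'

theorem grid_preconnected : grid.Preconnected := fun ⟨a, b⟩ ⟨c, d⟩ =>
  (SimpleGraph.reachable_of_forall_adj_add_one (e := fun n => (a, n))
    (grid_adj_snd_add_one a) b d).trans
  (SimpleGraph.reachable_of_forall_adj_add_one (e := fun n => (n, d))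
    (fun n => grid_adj_fst_add_one n d) a c)

-- The Jordan-type argument modulo two

/-- Every edge of the lattice has an end of the form `up a b`. -/
theorem exists_up_of_adj {u v : Vertex} (h : hexLattice.Adj u v) :
    ∃ a b, u = .up a b ∨ v = .up a b := by
  rcases h with ⟨a, b, rfl, -⟩ | ⟨a, b, rfl, -⟩
  · exact ⟨a, b, Or.inl rfl⟩
  · exact ⟨a, b, Or.inr rfl⟩

/-- The border edges meeting a set `S` of vertices that is closed under adjacency in the border
form a closed `1`-form modulo two on the dual lattice; this is a potential of it. -/
theorem exists_border_potential {A : Set Hexagon} {S : Set Vertex}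
    (hS : ∀ u v, (border A).Adj u v → (u ∈ S ↔ v ∈ S)) :
    ∃ φ : Hexagon → ZMod 2, ∀ u v, hexLattice.Adj u v → ∀ h ∈ edgeHexagons u v,
      ∀ k ∈ edgeHexagons u v, (φ h = φ k ↔ ((h ∈ A ↔ k ∈ A) ∨ u ∉ S)) := by
  classical
  have hS' {u v : Vertex} (huv : hexLattice.Adj u v) {h k : Hexagon} (hh : h ∈ edgeHexagons u v)
      (hk : k ∈ edgeHexagons u v) (hhk : ¬ (h ∈ A ↔ k ∈ A)) : u ∈ S ↔ v ∈ S := by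
    refine hS u v (border_adj_iff.2 ⟨huv, ?_, ?_⟩) <;> grind
  -- `f` and `g` are the jumps across two of the edges at `up a b`; each edge is tested for `S` at
  -- its `up` end.
  let f (a b : ℤ) : ZMod 2 :=
    if Vertex.up a b ∈ S ∧ ¬ ((a, b) ∈ A ↔ (a + 1, b) ∈ A) then 1 else 0
  let g (a b : ℤ) : ZMod 2 :=
    if Vertex.up a b ∈ S ∧ ¬ ((a, b) ∈ A ↔ (a, b + 1) ∈ A) then 1 else 0
  -- The unit square splits into the dual triangles of `up a b` and `down a b`. Around the second,
  -- `e1`, `e2`, `e3` replace the three `up` ends by the common end `down a b`; closedness then says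
  -- that an even number of border edges meet at a vertex.
  obtain ⟨φ, hf, hg⟩ := Int.exists_potential f g fun a b => by
    have e1 : ¬ ((a + 1, b) ∈ A ↔ (a, b + 1) ∈ A) → (Vertex.up a b ∈ S ↔ .down a b ∈ S) :=
      hS' (Or.inl ⟨a, b, rfl, by simp⟩) (by simp [edgeHexagons, Vertex.hexagons])
        (by simp [edgeHexagons, Vertex.hexagons])
    have e2 : ¬ ((a + 1, b) ∈ A ↔ (a + 1, b + 1) ∈ A) →
        (Vertex.up (a + 1) b ∈ S ↔ .down a b ∈ S) :=
      hS' (Or.inl ⟨a + 1, b, rfl, by simp⟩) (by simp [edgeHexagons, Vertex.hexagons])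
        (by simp [edgeHexagons, Vertex.hexagons])
    have e3 : ¬ ((a, b + 1) ∈ A ↔ (a + 1, b + 1) ∈ A) →
        (Vertex.up a (b + 1) ∈ S ↔ .down a b ∈ S) :=
      hS' (Or.inl ⟨a, b + 1, rfl, by simp⟩) (by simp [edgeHexagons, Vertex.hexagons])
        (by simp [edgeHexagons, Vertex.hexagons])
    simp only [f, g]
    generalize (Vertex.up a b ∈ S) = s at *
    generalize (Vertex.up (a + 1) b ∈ S) = s1 at *
    generalize (Vertex.up a (b + 1) ∈ S) = s2 at *
    generalize (Vertex.down a b ∈ S) = t at *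
    generalize ((a, b) ∈ A) = p at *
    generalize ((a + 1, b) ∈ A) = q at *
    generalize ((a, b + 1) ∈ A) = r at *
    generalize ((a + 1, b + 1) ∈ A) = w at *
    by_cases p <;> by_cases q <;> by_cases r <;> by_cases w <;> simp_all
    all_goals by_cases s <;> by_cases t <;> simp_all
    all_goals rfl
  have key (a b : ℤ) (h k : Hexagon) (hh : h ∈ (Vertex.up a b).hexagons)
      (hk : k ∈ (Vertex.up a b).hexagons) :
      φ h = φ k ↔ ((h ∈ A ↔ k ∈ A) ∨ Vertex.up a b ∉ S) := by
    have h1 := hf a b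
    have h2 := hg a b
    simp only [f, g] at h1 h2
    rcases hh with rfl | rfl | rfl <;> rcases hk with rfl | rfl | rfl <;>
      by_cases hs : Vertex.up a b ∈ S <;> by_cases hp : (a, b) ∈ A <;>
      by_cases hq : (a + 1, b) ∈ A <;> by_cases hr : (a, b + 1) ∈ A <;>
      simp [hs, hp, hq, hr] at h1 h2 ⊢ <;> simp [h1, h2]
  refine ⟨φ, fun u v huv h hh k hk => ?_⟩
  obtain ⟨a, b, rfl | rfl⟩ := exists_up_of_adj huv
  · exact key a b h k hh.1 hk.1
  · rw [key a b h k hh.2 hk.2]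
    -- Here the `up` end is `v`; on a border edge, membership in `S` passes from `v` to `u`.
    by_cases hhk : h ∈ A ↔ k ∈ A
    · simp [hhk]
    · rw [hS' huv hh hk hhk]

/-- Take for `S` the border component of `x`. The potential is constant on each side; an edge at `x`
forces the two constants apart, whereas an edge at some `y ∉ S` would force them together. -/
theorem border_connected {A : Set Hexagon} (hA : IsConnected A) (hA' : IsConnected Aᶜ) :
    (border A).Connected := by
  have hadj : ∃ u v, (border A).Adj u v := by
    obtain ⟨⟨h, hh⟩⟩ := hA.nonempty
    obtain ⟨⟨k, hk⟩⟩ := hA'.nonempty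
    obtain ⟨p⟩ := grid_preconnected h k
    -- A walk from `A` to `Aᶜ` must cross a border edge, so the border is non-empty.
    obtain ⟨d, -, hd1, hd2⟩ := p.exists_boundary_dart A hh hk
    obtain ⟨-, u, v, huv, h1, h2⟩ := d.adj
    exact ⟨u, v, border_adj_iff.2 ⟨huv, ⟨_, hd1, h1⟩, _, hd2, h2⟩⟩
  have hconst {φ : Hexagon → ZMod 2} {L : Set Hexagon} (hL : IsConnected L)
      (hφ : ∀ h ∈ L, ∀ k ∈ L, grid.Adj h k → φ h = φ k) {h k : Hexagon} (hh : h ∈ L)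
      (hk : k ∈ L) : φ h = φ k :=
    SimpleGraph.Reachable.eq_of_forall_adj (f := fun x : L => φ x)
      (fun x y hxy => hφ x x.2 y y.2 hxy) (hL.preconnected ⟨h, hh⟩ ⟨k, hk⟩)
  obtain ⟨u, v, huv⟩ := hadj
  have : Nonempty (border A).verts := ⟨⟨u, (border A).edge_vert huv⟩⟩
  refine ⟨⟨?_⟩⟩
  intro x y
  let S : Set Vertex := {w | ∃ hw : w ∈ (border A).verts, (border A).coe.Reachable x ⟨w, hw⟩}
  have hS1 (u v : Vertex) (huv : (border A).Adj u v) (hu : u ∈ S) : v ∈ S := by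
    obtain ⟨hu, hr⟩ := hu
    exact ⟨(border A).edge_vert huv.symm, hr.trans (SimpleGraph.Adj.reachable huv)⟩
  obtain ⟨φ, hφ⟩ := exists_border_potential (A := A) (S := S)
    fun u v huv => ⟨hS1 u v huv, hS1 v u huv.symm⟩
  have hφ' (h k : Hexagon) (hhk : h ∈ A ↔ k ∈ A) (hadj : grid.Adj h k) : φ h = φ k := by
    obtain ⟨-, u, v, huv, h1, h2⟩ := hadj
    exact (hφ u v huv h h1 k h2).2 (Or.inl hhk)
  obtain ⟨x', hx⟩ := exists_border_adj x.2
  obtain ⟨y', hy⟩ := exists_border_adj y.2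
  obtain ⟨hxl, ⟨h, hA1, h1⟩, k, hA2, h2⟩ := border_adj_iff.1 hx
  obtain ⟨hyl, ⟨h', hA1', h1'⟩, k', hA2', h2'⟩ := border_adj_iff.1 hy
  have e1 : φ h = φ h' :=
    hconst hA (fun h hh k hk => hφ' h k (by simp [hh, hk])) hA1 hA1'
  have e2 : φ k = φ k' :=
    hconst hA' (fun h hh k hk => hφ' h k (by simp_all)) hA2 hA2'
  have hxS : (x : Vertex) ∈ S := ⟨x.2, SimpleGraph.Reachable.refl _⟩
  have hne : φ h ≠ φ k := fun he => by
    simpa [hA1, hA2, hxS] using (hφ _ _ hxl h h1 k h2).1 he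
  have hyS : (y : Vertex) ∈ S := by
    by_contra hyS
    exact hne (e1.trans (((hφ _ _ hyl h' h1' k' h2').2 (Or.inr hyS)).trans e2.symm))
  exact hyS.2

-- Components of the complement and their borders

namespace Component

variable {K : Set Hexagon} {B B' : Component K}

theorem mem_cells_iff {h : Hexagon} :
    h ∈ B.cells ↔ ∃ hh : h ∈ K, (grid.induce K).connectedComponentMk ⟨h, hh⟩ = B := by
  simp [cells]

theorem eq_of_mem_cells {h : Hexagon} (hB : h ∈ B.cells) (hB' : h ∈ B'.cells) : B = B' := by
  obtain ⟨_, rfl⟩ := mem_cells_iff.1 hB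
  obtain ⟨_, rfl⟩ := mem_cells_iff.1 hB'
  rfl

theorem cells_subset (B : Component K) : B.cells ⊆ K := fun _ h => (mem_cells_iff.1 h).1

theorem mem_cells_of_adj {h k : Hexagon} (hB : h ∈ B.cells) (hk : k ∈ K) (hadj : grid.Adj h k) :
    k ∈ B.cells := by
  obtain ⟨hh, rfl⟩ := mem_cells_iff.1 hB
  refine mem_cells_iff.2 ⟨hk, SimpleGraph.ConnectedComponent.sound ?_⟩
  exact SimpleGraph.Adj.reachable (G := grid.induce K) hadj.symm

theorem mem_cells_of_mem_hexagons {v : Vertex} {h k : Hexagon} (hB : h ∈ B.cells) (hk : k ∈ K)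
    (hv : h ∈ v.hexagons) (hv' : k ∈ v.hexagons) : k ∈ B.cells := by
  by_cases hhk : h = k
  · exact hhk ▸ hB
  · exact mem_cells_of_adj hB hk (grid_adj_of_mem_hexagons hv hv' hhk)

/-- A walk in `K` that starts in `B` never leaves it, so it lifts to the graph induced on `B.cells`.
-/
theorem cells_isConnected (B : Component K) : IsConnected B.cells := by
  have key (x y : K) (p : (grid.induce K).Walk x y) (hx : (x : Hexagon) ∈ B.cells) :
      ∃ hy : (y : Hexagon) ∈ B.cells, (grid.induce B.cells).Reachable ⟨x, hx⟩ ⟨y, hy⟩ := by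
    induction p with
    | nil => exact ⟨hx, SimpleGraph.Reachable.refl _⟩
    | @cons u v w hadj _ ih =>
      have hv : (v : Hexagon) ∈ B.cells := mem_cells_of_adj hx v.2 hadj
      obtain ⟨hw, hr⟩ := ih hv
      refine ⟨hw, .trans ?_ hr⟩
      exact SimpleGraph.Adj.reachable (G := grid.induce B.cells) hadj
  have : Nonempty B.cells := by
    obtain ⟨h, rfl⟩ := B.exists_rep
    exact ⟨⟨h, mem_cells_iff.2 ⟨h.2, rfl⟩⟩⟩
  refine ⟨fun x y => ?_⟩
  obtain ⟨hx, ex⟩ := mem_cells_iff.1 x.2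
  obtain ⟨hy, ey⟩ := mem_cells_iff.1 y.2
  obtain ⟨p⟩ := SimpleGraph.ConnectedComponent.exact (ex.trans ey.symm)
  exact (key _ _ p x.2).2

end Component

open Component

variable {K : Set Hexagon}

/-- Follow a grid walk from a hexagon outside `B` towards `K`. It cannot enter `B` before meeting
`K`, since a neighbour of `B` off `K` is itself in `B`; once in `K`, connectedness of `K` finishes.
-/
theorem compl_cells_isConnected (hK : IsConnected K) (B : Component Kᶜ) :
    IsConnected B.cellsᶜ := by
  have hsub : K ⊆ B.cellsᶜ := fun h hh hB => B.cells_subset hB hh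
  obtain ⟨⟨k, hk⟩⟩ := hK.nonempty
  have key (h : Hexagon) (p : grid.Walk h k) (hh : h ∉ B.cells) :
      (grid.induce B.cellsᶜ).Reachable ⟨h, hh⟩ ⟨k, hsub hk⟩ := by
    induction p with
    | nil => exact SimpleGraph.Reachable.refl _
    | @cons u v w hadj _ ih =>
      by_cases hu : u ∈ K
      · exact (hK.preconnected ⟨u, hu⟩ ⟨w, hk⟩).map
          (grid.induceHomOfLE hsub).toHom
      · have hv : v ∉ B.cells := fun hv => hh (mem_cells_of_adj hv hu hadj.symm)
        refine .trans ?_ (ih hk hv)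
        exact SimpleGraph.Adj.reachable (G := grid.induce B.cellsᶜ) hadj
  have : Nonempty (B.cellsᶜ : Set Hexagon) := ⟨⟨k, hsub hk⟩⟩
  refine ⟨fun x y => ?_⟩
  exact (key x (grid_preconnected _ _).some x.2).trans
    (key y (grid_preconnected _ _).some y.2).symm

/-- At a vertex touching `B`, any hexagon outside `B` must lie in `K`, because hexagons at one
vertex are mutually adjacent. -/
theorem mem_border_cells_verts_iff (B : Component Kᶜ) {v : Vertex} :
    v ∈ (border B.cells).verts ↔ v ∈ (border K).verts ∧ ∃ h ∈ B.cells, h ∈ v.hexagons := by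
  rw [mem_border_verts_iff, mem_border_verts_iff]
  constructor
  · rintro ⟨⟨h, hB, hv⟩, k, hkB, hk⟩
    have hkK : k ∈ K := by
      by_contra hkK
      exact hkB (mem_cells_of_mem_hexagons hB hkK hv hk)
    exact ⟨⟨⟨k, hkK, hk⟩, h, B.cells_subset hB, hv⟩, h, hB, hv⟩
  · rintro ⟨⟨⟨k, hkK, hk⟩, -⟩, h, hB, hv⟩
    exact ⟨⟨h, hB, hv⟩, k, fun hkB => B.cells_subset hkB hkK, hk⟩

theorem border_cells_adj_iff (B : Component Kᶜ) {u v : Vertex} :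
    (border B.cells).Adj u v ↔ (border K).Adj u v ∧ ∃ h ∈ B.cells, h ∈ edgeHexagons u v := by
  rw [border_adj_iff, border_adj_iff]
  constructor
  · rintro ⟨huv, ⟨h, hB, hv⟩, k, hkB, hk⟩
    have hkK : k ∈ K := by
      by_contra hkK
      exact hkB (mem_cells_of_mem_hexagons hB hkK hv.1 hk.1)
    exact ⟨⟨huv, ⟨k, hkK, hk⟩, h, B.cells_subset hB, hv⟩, h, hB, hv⟩
  · rintro ⟨⟨huv, ⟨k, hkK, hk⟩, -⟩, h, hB, hv⟩
    exact ⟨huv, ⟨h, hB, hv⟩, k, fun hkB => B.cells_subset hkB hkK, hk⟩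

theorem border_cells_le (B : Component Kᶜ) : border B.cells ≤ border K :=
  ⟨fun _ h => ((mem_border_cells_verts_iff B).1 h).1, fun _ _ h => ((border_cells_adj_iff B).1 h).1⟩

theorem border_cells_connected (hK : IsConnected K) (B : Component Kᶜ) :
    (border B.cells).Connected :=
  border_connected B.cells_isConnected (compl_cells_isConnected hK B)

/-- Finiteness comes from `K`, not from `B`, so the unbounded component is covered too. -/
theorem border_cells_isCycleGraph (hK : IsCoronoid K) (B : Component Kᶜ) :
    IsCycleGraph (border B.cells) :=
  SimpleGraph.Subgraph.exists_isCycle_toSubgraph_eq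
    ((finite_skeleton_verts hK.finite).subset
      ((border_cells_le B).1.trans (border_le_skeleton K).1))
    (border_cells_connected hK.connected B) fun _ => ncard_neighborSet_border

theorem eq_of_mem_border_cells {B B' : Component Kᶜ} {v : Vertex}
    (h : v ∈ (border B.cells).verts) (h' : v ∈ (border B'.cells).verts) : B = B' := by
  obtain ⟨-, k, hk, hv⟩ := (mem_border_cells_verts_iff B).1 h
  obtain ⟨-, k', hk', hv'⟩ := (mem_border_cells_verts_iff B').1 h'
  exact eq_of_mem_cells (mem_cells_of_mem_hexagons hk (B'.cells_subset hk') hv hv') hk'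

theorem exists_mem_border_cells {v : Vertex} (h : v ∈ (border K).verts) :
    ∃ B : Component Kᶜ, v ∈ (border B.cells).verts := by
  obtain ⟨k, hk, hv⟩ := (mem_border_verts_iff.1 h).2
  exact ⟨(grid.induce Kᶜ).connectedComponentMk ⟨k, hk⟩,
    (mem_border_cells_verts_iff _).2 ⟨h, k, mem_cells_iff.2 ⟨hk, rfl⟩, hv⟩⟩

theorem border_eq_iSup : border K = ⨆ B : Component Kᶜ, border B.cells := by
  refine le_antisymm ?_ (iSup_le border_cells_le)
  constructor
  · intro v hv
    rw [SimpleGraph.Subgraph.verts_iSup]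
    exact Set.mem_iUnion.2 (exists_mem_border_cells hv)
  · intro u v huv
    rw [SimpleGraph.Subgraph.iSup_adj]
    obtain ⟨-, -, k, hk, hv⟩ := border_adj_iff.1 huv
    exact ⟨(grid.induce Kᶜ).connectedComponentMk ⟨k, hk⟩,
      (border_cells_adj_iff _).2 ⟨huv, k, mem_cells_iff.2 ⟨hk, rfl⟩, hv⟩⟩

-- Counting components and holes

/-- Choosing a vertex on each border is injective, by disjointness, and lands in the finite
skeleton. -/
theorem finite_component_compl (hK : IsCoronoid K) : Finite (Component Kᶜ) := by
  have : Finite (skeleton K).verts := finite_skeleton_verts hK.finite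
  choose f hf using fun B : Component Kᶜ => (border_cells_connected hK.connected B).nonempty
  refine Finite.of_injective (β := (skeleton K).verts)
    (fun B => ⟨f B, (border_le_skeleton K).1 ((border_cells_le B).1 (hf B))⟩) fun B B' h => ?_
  have h' : f B = f B' := congrArg Subtype.val h
  exact eq_of_mem_border_cells (hf B) (h' ▸ hf B')

theorem card_connectedComponent_border (hK : IsConnected K) :
    Nat.card (border K).coe.ConnectedComponent = numComplComponents K := by
  choose f hf using fun B : Component Kᶜ => (border_cells_connected hK B).nonempty
  refine (Nat.card_eq_of_bijective (fun B => (border K).coe.connectedComponentMk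
    ⟨f B, (border_cells_le B).1 (hf B)⟩) ⟨fun B B' h => ?_, fun c => ?_⟩).symm
  · have hr : (border K).coe.Reachable _ _ := SimpleGraph.ConnectedComponent.exact h
    -- The hexagon off `K` on the edge `uv` contains `u`, hence belongs to `B`, and it also contains
    -- `v`. Thus lying on the border of `B` is invariant along the border of `K`.
    have step {u v : Vertex} (huv : (border K).Adj u v)
        (hu : u ∈ (border B.cells).verts) : v ∈ (border B.cells).verts := by
      obtain ⟨-, k, hk, hv⟩ := (mem_border_cells_verts_iff B).1 hu
      obtain ⟨-, -, l, hl, hv'⟩ := border_adj_iff.1 huv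
      exact (mem_border_cells_verts_iff B).2 ⟨(border K).edge_vert huv.symm, l,
        mem_cells_of_mem_hexagons hk hl hv hv'.1, hv'.2⟩
    have := hr.eq_of_forall_adj
      (f := fun x : (border K).verts => (x : Vertex) ∈ (border B.cells).verts)
      fun u v (huv : (border K).Adj u v) => propext ⟨step huv, step huv.symm⟩
    exact eq_of_mem_border_cells (this.mp (hf B)) (hf B')
  · obtain ⟨v, rfl⟩ := c.exists_rep
    obtain ⟨B, hB⟩ := exists_mem_border_cells v.2
    refine ⟨B, SimpleGraph.ConnectedComponent.sound ?_⟩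
    exact ((border_cells_connected hK B).coe.preconnected ⟨f B, hf B⟩ ⟨v, hB⟩).map
      (SimpleGraph.Subgraph.inclusion (border_cells_le B))

theorem isConnected_iff_card_component {L : Set Hexagon} :
    IsConnected L ↔ Nat.card (Component L) = 1 := by
  rw [Nat.card_eq_one_iff_unique]
  constructor
  · intro h
    exact ⟨h.preconnected.subsingleton_connectedComponent,
      ⟨(grid.induce L).connectedComponentMk h.nonempty.some⟩⟩
  · rintro ⟨hs, ⟨C⟩⟩
    obtain ⟨x, -⟩ := C.exists_rep
    have : Nonempty L := ⟨x⟩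
    exact ⟨fun x y => SimpleGraph.ConnectedComponent.exact (Subsingleton.elim _ _)⟩

/-- The complement of a finite hexagonal system has exactly one infinite component. -/
theorem existsUnique_infinite_component (hK : K.Finite) :
    ∃! B : Component Kᶜ, B.cells.Infinite := by
  obtain ⟨N, hN⟩ := (hK.image fun h => max |h.1| |h.2|).bddAbove
  have hN1 {a b : ℤ} (h : N < |a| ∨ N < |b|) : (a, b) ∈ Kᶜ := fun hab => by
    have : max |a| |b| ≤ N := hN ⟨_, hab, rfl⟩
    rw [max_le_iff] at this
    omega
  have hpos : N < |N + 1| := (lt_add_one N).trans_le (le_abs_self _)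
  have hcorner : (N + 1, N + 1) ∈ Kᶜ := hN1 (Or.inl hpos)
  -- Outside the box of radius `N`, the whole column or the whole row through the hexagon avoids
  -- `K`. It meets row or column `N + 1`, which leads to the corner.
  have hreach (a b : ℤ) (h : N < |a| ∨ N < |b|) :
      (grid.induce Kᶜ).Reachable ⟨(a, b), hN1 h⟩ ⟨_, hcorner⟩ := by
    rcases h with h | h
    · exact (reachable_of_column_subset (fun b => hN1 (Or.inl h)) b (N + 1)).trans
        (reachable_of_row_subset (fun a => hN1 (Or.inr hpos)) a (N + 1))
    · exact (reachable_of_row_subset (fun a => hN1 (Or.inr h)) a (N + 1)).trans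
        (reachable_of_column_subset (fun b => hN1 (Or.inl hpos)) b (N + 1))
  refine ⟨(grid.induce Kᶜ).connectedComponentMk ⟨_, hcorner⟩, ?_, fun B hB => ?_⟩
  · refine (Set.infinite_range_of_injective (f := fun a : ℤ => (a, N + 1))
      fun a b h => congrArg Prod.fst h).mono ?_
    rintro _ ⟨a, rfl⟩
    exact mem_cells_iff.2 ⟨_, SimpleGraph.ConnectedComponent.sound (hreach a _ (Or.inr hpos))⟩
  -- An infinite component cannot fit in the finite box, so it has a hexagon that is joined to the
  -- corner.
  · obtain ⟨⟨a, b⟩, hab, hout⟩ :=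
      hB.exists_notMem_finite ((Set.finite_Icc (-N) N).prod (Set.finite_Icc (-N) N))
    obtain ⟨_, rfl⟩ := mem_cells_iff.1 hab
    refine SimpleGraph.ConnectedComponent.sound (hreach a b ?_)
    rw [Set.mem_prod, Set.mem_Icc, Set.mem_Icc, ← abs_le, ← abs_le] at hout
    by_contra! hcon
    exact hout hcon

theorem ncard_coronaHoles_add_one (hK : IsCoronoid K) :
    (coronaHoles K).ncard + 1 = numComplComponents K := by
  have := finite_component_compl hK
  obtain ⟨B, hB, hu⟩ := existsUnique_infinite_component hK.finite
  have hc : (coronaHoles K)ᶜ = {B} := by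
    ext B'
    exact ⟨hu B', fun h => h ▸ hB⟩
  rw [numComplComponents, ← Set.ncard_add_ncard_compl (coronaHoles K), hc, Set.ncard_singleton]

end HexGrid

theorem mainTheorem9 (K : Set Hexagon) (hK : IsCoronoid K) :
    -- the number `b(K)` of components of the complement is finite and positive
    Finite (Component Kᶜ) ∧ 1 ≤ numComplComponents K ∧
    -- the border is the disjoint union of cycles, one for each component of the complement, the
    -- cycle of `B` being formed by the border edges that lie on a hexagon of `B`
    (∃ C : Component Kᶜ → hexLattice.Subgraph,
      Function.Injective C ∧
      (∀ B, IsCycleGraph (C B)) ∧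
      (∀ B B', B ≠ B' → Disjoint (C B).verts (C B').verts) ∧
      border K = ⨆ B, C B ∧
      (∀ B u v, (C B).Adj u v ↔
        (border K).Adj u v ∧ ∃ h ∈ B.cells, h ∈ edgeHexagons u v)) ∧
    -- the number of cycles (connected components) of the border is exactly `b(K)`
    Nat.card (border K).coe.ConnectedComponent = numComplComponents K ∧
    (IsBenzenoid K ↔ numComplComponents K = 1) ∧
    (IsProperCoronoid K ↔ 1 < numComplComponents K) ∧
    (coronaHoles K).ncard + 1 = numComplComponents K := by
  have hholes := ncard_coronaHoles_add_one hK
  have hbenz : IsBenzenoid K ↔ numComplComponents K = 1 :=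
    ⟨fun h => isConnected_iff_card_component.1 h.compl_connected,
      fun h => ⟨hK.finite, hK.connected, isConnected_iff_card_component.2 h⟩⟩
  refine ⟨finite_component_compl hK, by omega, ⟨fun B => border B.cells, fun B B' h => ?_,
    border_cells_isCycleGraph hK, fun B B' hne => ?_, border_eq_iSup,
    fun B _ _ => border_cells_adj_iff B⟩, card_connectedComponent_border hK.connected, hbenz, ?_,
    hholes⟩
  -- Disjointness yields injectivity only because no border is empty.
  · obtain ⟨v, hv⟩ := (border_cells_connected hK.connected B).nonempty
    have h' : border B.cells = border B'.cells := h
    exact eq_of_mem_border_cells hv (h' ▸ hv)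
  · exact Set.disjoint_left.2 fun v hv hv' => hne (eq_of_mem_border_cells hv hv')
  · rw [IsProperCoronoid, hbenz, and_iff_right hK]
    omega
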